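/- All graphs are finite, simple and undirected. The connectivity $\kappa(G)$ is the minimum of $|S|$ over the sets $S\subseteq V(G)$ such that $G-S$ is disconnected or has at most one vertex. For a set $S$ of vertices of $G$, trees $T_1,\dots,T_r\subseteq G$ are called internally disjoint $S$-trees if $S\subseteq V(T_i)$ for all $i$, and $E(T_i)\cap E(T_j)=\emptyset$ and $V(T_i)\cap V(T_j)=S$ for all $i\ne j$; $\kappa(S)$ is the greatest number of internally disjoint $S$-trees in $G$. The generalized $3$-connectivity $\kappa_3(G)$ is the minimum of $\kappa(S)$ over all $S\subseteq V(G)$ with $|S|=3$; if $G$ has fewer than three vertices, then $\kappa_3(G)=1$ if $G$ is connected and $\kappa_3(G)=0$ otherwise. Let $P_m$ be the path with $m$ vertices and $\Box$ the Cartesian product of graphs. **Theorem 3.1.** Let $G$ be a graph. (i) If $\kappa_3(G)=\kappa(G)\ge 1$, then $\kappa_3(G\Box P_m)\ge\kappa_3(G)$ for every $m\ge 1$. The bound is sharp: for every $k\ge 1$ there is a graph $G$ with $\kappa_3(G)=\kappa(G)=k$ and $\kappa_3(G\Box P_2)=k$. (ii) If $1\le\kappa_3(G)<\kappa(G)$,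 then $\kappa_3(G\Box P_m)\ge\kappa_3(G)+1$ for every $m\ge 2$. The bound is sharp: for every $k\ge 1$ there is a graph $G$ with $\kappa_3(G)=k<\kappa(G)$ and $\kappa_3(G\Box P_2)=k+1$. -/

import Mathlib

namespace GenConn

variable {V : Type*}

/-- The (vertex) connectivity `κ(G)`: the least size of a set `S` of vertices such that `G - S` is
disconnected or trivial (at most one vertex). -/
noncomputable def vertexConnectivity (G : SimpleGraph V) : ℕ :=
  sInf {n : ℕ | ∃ S : Finset V, S.card = n ∧
    (¬ (G.induce ((S : Set V)ᶜ)).Preconnected ∨ ((S : Set V)ᶜ).Subsingleton)}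

/-- An `S`-tree of `G`: a subgraph of `G` that is a tree and contains all vertices of `S`. -/
def IsSTree (G : SimpleGraph V) (S : Finset V) (T : G.Subgraph) : Prop :=
  T.coe.IsTree ∧ (S : Set V) ⊆ T.verts

/-- `T 0, …, T (r - 1)` are internally disjoint `S`-trees of `G`: any two of them have no common
edge, and their common vertices are exactly those of `S`. -/
def InternallyDisjointSTrees (G : SimpleGraph V) (S : Finset V) {r : ℕ}
    (T : Fin r → G.Subgraph) : Prop :=
  (∀ i, IsSTree G S (T i)) ∧
    ∀ i j, i ≠ j →
      Disjoint (T i).edgeSet (T j).edgeSet ∧ (T i).verts ∩ (T j).verts = (S : Set V)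

/-- `κ(S)`: the greatest number of internally disjoint `S`-trees of `G`. (For a finite graph and
`2 ≤ |S|` the set is bounded, because every `S`-tree has an edge.) -/
noncomputable def treeConnectivity (G : SimpleGraph V) (S : Finset V) : ℕ :=
  sSup {r : ℕ | ∃ T : Fin r → G.Subgraph, InternallyDisjointSTrees G S T}

open Classical in
/-- The generalized `k`-connectivity `κ_k(G)` of a finite graph: the minimum of `κ(S)` over the
sets `S` of `k` vertices. By convention it is `1` for a connected graph with fewer than `k`
vertices (and `0` for a disconnected one). -/
noncomputable def genConnectivity (k : ℕ) (G : SimpleGraph V) : ℕ :=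
  if k ≤ Nat.card V then
    sInf {n : ℕ | ∃ S : Finset V, S.card = k ∧ treeConnectivity G S = n}
  else if G.Connected then 1 else 0

end GenConn

/-!
Throughout, the `S`-trees are produced as connected subgraphs that meet only in `S` and share no
edge (`ConnectedSystem`); spanning trees of these subgraphs are internally disjoint `S`-trees.

*Lower bounds.* Let `S` consist of three vertices of `G □ H`, where `H` is connected. If they do not
lie in one layer, then `κ(G)` trees exist, whatever `κ₃(G)` is. One chooses `κ(G)` columns, given
by distinct vertices `u a` of `G`, and in every layer a system through the vertices of `S` in that
layer whose `a`-th member contains `u a`; joining the `a`-th members along the column of `u a`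
gives the `a`-th tree (`exists_system_boxProd`). At most one layer contains two vertices of `S`. It
dictates the columns (`exists_pair_system`), and in the other layers a fan to any prescribed
columns is available (`exists_fan`). If `S` lies in one layer, the `κ₃(G)` trees of `G` are copied
to that layer, and a neighbouring layer, if there is one, supplies a further tree
(`ConnectedSystem.exists_layer_succ`).

The fan lemma is derived from Hall's theorem. For `v ∉ U` and `|U| ≤ κ(G)`, Hall's condition for an
injective map `f` from the vertices at distance at least two from `v` to the vertices outside `U`,
with `f w` equal or adjacent to `w`, says that fewer than `|U|` vertices do not separate `v` from
`U`. The orbits of the elements of `U` under `f` are disjoint and end at neighbours of `v`.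

*Sharpness.* In a system through `S` a vertex of `S` has a private edge in each member, so `κ₃` is at
most the minimum degree; if two adjacent vertices of `S` have `d` further neighbours each, the
size is at most `d` (`ConnectedSystem.card_le_of_adj`). Applied to the two copies of a vertex of
`G`, this bounds `κ₃(G □ P₂)` by the minimum degree of `G`. Complete split graphs, with
`κ₃ = κ = k` equal to the minimum degree, and the complete graphs on `k + 2` vertices, with `κ₃ = k`
and `κ = k + 1`, attain the lower bounds.
-/

namespace GenConn

variable {V W : Type*} {G : SimpleGraph V} {H : SimpleGraph W}

/-! ### Connected subgraphs -/

lemma connected_of_reflTransGen {H : G.Subgraph} {r : V} (hr : r ∈ H.verts)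
    (h : ∀ v ∈ H.verts, Relation.ReflTransGen H.Adj r v) : H.Connected := by
  have key : ∀ v, Relation.ReflTransGen H.Adj r v →
      ∃ hv : v ∈ H.verts, H.coe.Reachable ⟨r, hr⟩ ⟨v, hv⟩ := by
    intro v hv
    induction hv with
    | refl => exact ⟨hr, .refl _⟩
    | @tail b c _ hbc ih =>
      obtain ⟨hb, hrb⟩ := ih
      exact ⟨H.edge_vert hbc.symm, hrb.trans (SimpleGraph.Adj.reachable (by simpa using hbc))⟩
  refine SimpleGraph.Subgraph.connected_iff'.2 ((SimpleGraph.connected_iff _).2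
    ⟨fun a b => ?_, ⟨⟨r, hr⟩⟩⟩)
  obtain ⟨_, ha⟩ := key a (h a a.2)
  obtain ⟨_, hb⟩ := key b (h b b.2)
  exact ha.symm.trans hb

lemma reflTransGen_of_connected {H : G.Subgraph} (hH : H.Connected) {a b : V}
    (ha : a ∈ H.verts) (hb : b ∈ H.verts) : Relation.ReflTransGen H.Adj a b := by
  have h := (SimpleGraph.reachable_iff_reflTransGen _ _).1 (hH.coe.preconnected ⟨a, ha⟩ ⟨b, hb⟩)
  exact h.lift Subtype.val (fun x y hxy => by simpa using hxy)

lemma exists_adj_of_preconnected (hG : G.Preconnected) (P : Set V) {a b : V}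
    (ha : a ∈ P) (hb : b ∉ P) : ∃ x y, x ∈ P ∧ y ∉ P ∧ G.Adj x y := by
  obtain ⟨w⟩ := hG a b
  obtain ⟨d, -, h1, h2⟩ := w.exists_boundary_dart P ha hb
  exact ⟨_, _, h1, h2, d.adj⟩

lemma exists_adj_of_connected {H : G.Subgraph} (hH : H.Connected) (P : Set V) {a b : V}
    (haH : a ∈ H.verts) (hbH : b ∈ H.verts) (ha : a ∈ P) (hb : b ∉ P) :
    ∃ x y, x ∈ P ∧ y ∉ P ∧ H.Adj x y := by
  obtain ⟨x, y, hx, hy, hxy⟩ := exists_adj_of_preconnected hH.coe.preconnected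
    (Subtype.val ⁻¹' P) (a := ⟨a, haH⟩) (b := ⟨b, hbH⟩) ha hb
  exact ⟨x, y, hx, hy, by simpa using hxy⟩

/-- Every connected subgraph contains a spanning tree. -/
lemma exists_spanning_tree [Finite V] {H : G.Subgraph} (hH : H.Connected) :
    ∃ T : G.Subgraph, T ≤ H ∧ T.verts = H.verts ∧ T.coe.IsTree := by
  obtain ⟨T, hT, hTree⟩ := hH.coe.exists_isTree_le
  let T' : G.Subgraph :=
    { verts := H.verts
      Adj := fun a b => ∃ (ha : a ∈ H.verts) (hb : b ∈ H.verts), T.Adj ⟨a, ha⟩ ⟨b, hb⟩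
      adj_sub := fun ⟨_, _, h⟩ => H.adj_sub (by simpa using hT h)
      edge_vert := fun ⟨ha, _, _⟩ => ha
      symm := ⟨fun _ _ ⟨ha, hb, h⟩ => ⟨hb, ha, h.symm⟩⟩ }
  have hcoe : T'.coe = T := by
    ext ⟨a, ha⟩ ⟨b, hb⟩
    exact ⟨fun ⟨_, _, h⟩ => h, fun h => ⟨ha, hb, h⟩⟩
  refine ⟨T', ⟨le_rfl, fun a b ⟨_, _, h⟩ => by simpa using hT h⟩, rfl, ?_⟩
  rw [hcoe]
  exact hTree

/-! ### Systems of connected subgraphs through a vertex set -/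

/-- A family of connected subgraphs through all vertices of `S`, pairwise without common edges and
without common vertices outside `S`. Up to replacing each member by a spanning tree, this is a family
of internally disjoint `S`-trees; here `S` may also be empty or a singleton. -/
structure ConnectedSystem {ι : Type*} (G : SimpleGraph V) (S : Set V) (H : ι → G.Subgraph) :
    Prop where
  connected : ∀ i, (H i).Connected
  subset : ∀ i, S ⊆ (H i).verts
  inter : ∀ i j, i ≠ j → ∀ v, v ∈ (H i).verts → v ∈ (H j).verts → v ∈ S
  edge : ∀ i j, i ≠ j → ∀ v w, (H i).Adj v w → ¬ (H j).Adj v w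

lemma ConnectedSystem.comp {ι κ : Type*} {S : Set V} {H : ι → G.Subgraph}
    (h : ConnectedSystem G S H) {f : κ → ι} (hf : Function.Injective f) :
    ConnectedSystem G S (H ∘ f) :=
  ⟨fun _ => h.connected _, fun _ => h.subset _, fun _ _ hij => h.inter _ _ (hf.ne hij),
    fun _ _ hij => h.edge _ _ (hf.ne hij)⟩

lemma InternallyDisjointSTrees.connectedSystem {S : Finset V} {r : ℕ} {T : Fin r → G.Subgraph}
    (h : InternallyDisjointSTrees G S T) : ConnectedSystem G (S : Set V) T := by
  refine ⟨fun i => ⟨(h.1 i).1.1⟩, fun i => (h.1 i).2, fun i j hij _ hi hj => ?_,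
    fun i j hij v w hi hj => ?_⟩
  · rw [← (h.2 i j hij).2]
    exact ⟨hi, hj⟩
  · exact Set.disjoint_left.1 (h.2 i j hij).1 (show s(v, w) ∈ (T i).edgeSet from hi) hj

lemma ConnectedSystem.card_le {ι : Type*} [Fintype ι] {S : Set V} {H : ι → G.Subgraph}
    (h : ConnectedSystem G S H) (s : V) (N : Finset V)
    (hN : ∀ i, ∃ w ∈ N, (H i).Adj s w) : Fintype.card ι ≤ N.card := by
  choose f hfN hf using hN
  rw [← Finset.card_univ]
  refine Finset.card_le_card_of_injOn f (fun i _ => hfN i) fun i _ j _ hij => ?_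
  by_contra hne
  have := hf j
  rw [← hij] at this
  exact h.edge i j hne _ _ (hf i) this

/-- A system through at least two vertices is no larger than the degree of any of them. -/
lemma ConnectedSystem.card_le_of_mem {ι : Type*} [Fintype ι] {S : Set V}
    {H : ι → G.Subgraph} (h : ConnectedSystem G S H) {s s' : V} (hs : s ∈ S) (hs' : s' ∈ S)
    (hne : s' ≠ s) (N : Finset V) (hN : ∀ w, G.Adj s w → w ∈ N) : Fintype.card ι ≤ N.card := by
  refine h.card_le s N fun i => ?_
  obtain ⟨x, y, hx, -, hxy⟩ := exists_adj_of_connected (h.connected i) {s} (h.subset i hs)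
    (h.subset i hs') rfl hne
  obtain rfl : x = s := hx
  exact ⟨y, hN y hxy.adj_sub, hxy⟩

/-- If two adjacent vertices of `S` have at most `d` further neighbours each and `S` has a third
vertex, then a system through `S` has at most `d` members: the edge between the two vertices lies in
at most one member, so that one of the two vertices has in every member a neighbour different from
the other. -/
lemma ConnectedSystem.card_le_of_adj {ι : Type*} [Fintype ι] {S : Set V}
    {H : ι → G.Subgraph} (h : ConnectedSystem G S H) {a b c : V} (ha : a ∈ S) (hb : b ∈ S)
    (hc : c ∈ S) (hab : a ≠ b) (hca : c ≠ a) (hcb : c ≠ b) {d : ℕ} (Na Nb : Finset V)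
    (hNa : ∀ w, G.Adj a w → w ≠ b → w ∈ Na) (hNb : ∀ w, G.Adj b w → w ≠ a → w ∈ Nb)
    (hda : Na.card ≤ d) (hdb : Nb.card ≤ d) : Fintype.card ι ≤ d := by
  by_cases hall : ∀ i, ∃ w, w ≠ b ∧ (H i).Adj a w
  · refine (h.card_le a Na fun i => ?_).trans hda
    obtain ⟨w, hw, hadj⟩ := hall i
    exact ⟨w, hNa w hadj.adj_sub hw, hadj⟩
  · push Not at hall
    obtain ⟨i, hi⟩ := hall
    have hiab : (H i).Adj a b := by
      obtain ⟨x, y, hx, -, hxy⟩ := exists_adj_of_connected (h.connected i) {a} (h.subset i ha)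
        (h.subset i hb) rfl hab.symm
      obtain rfl : x = a := hx
      by_cases hy : y = b
      · rwa [hy] at hxy
      · exact absurd hxy (hi y hy)
    refine (h.card_le b Nb fun j => ?_).trans hdb
    suffices ∃ w, w ≠ a ∧ (H j).Adj b w by
      obtain ⟨w, hw, hadj⟩ := this
      exact ⟨w, hNb w hadj.adj_sub hw, hadj⟩
    by_cases hij : j = i
    · subst hij
      obtain ⟨x, y, hx, hy, hxy⟩ := exists_adj_of_connected (h.connected j) {a, b} (h.subset j ha)
        (h.subset j hc) (by simp) (by simp [hca, hcb])
      simp only [Set.mem_insert_iff, Set.mem_singleton_iff, not_or] at hx hy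
      rcases hx with rfl | rfl
      · exact absurd hxy (hi y hy.2)
      · exact ⟨y, hy.1, hxy⟩
    · obtain ⟨x, y, hx, -, hxy⟩ := exists_adj_of_connected (h.connected j) {b} (h.subset j hb)
        (h.subset j ha) rfl hab
      obtain rfl : x = b := hx
      refine ⟨y, ?_, hxy⟩
      rintro rfl
      exact h.edge j i hij _ _ hxy hiab.symm

lemma bddAbove_internallyDisjointSTrees [Finite V] {S : Finset V} (hS : 1 < S.card) :
    BddAbove {r : ℕ | ∃ T : Fin r → G.Subgraph, InternallyDisjointSTrees G S T} := by
  have := Fintype.ofFinite V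
  obtain ⟨s, hs, s', hs', hne⟩ := Finset.one_lt_card.1 hS
  refine ⟨(Finset.univ : Finset V).card, ?_⟩
  rintro r ⟨T, hT⟩
  simpa using hT.connectedSystem.card_le_of_mem (s := s) (s' := s') hs hs' hne.symm Finset.univ
    (by simp)

lemma ConnectedSystem.le_treeConnectivity [Finite V] {ι : Type*} [Fintype ι] {S : Finset V}
    (hS : 1 < S.card) {H : ι → G.Subgraph} (h : ConnectedSystem G (S : Set V) H) :
    Fintype.card ι ≤ treeConnectivity G S := by
  refine le_csSup (bddAbove_internallyDisjointSTrees hS) ?_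
  have h' := h.comp (Fintype.equivFin ι).symm.injective
  choose T hle hv hT using fun i => exists_spanning_tree (h'.connected i)
  refine ⟨T, fun i => ⟨hT i, hv i ▸ h'.subset i⟩, fun i j hij => ⟨?_, ?_⟩⟩
  · rw [Set.disjoint_left]
    intro e
    induction e using Sym2.ind with
    | _ v w => exact fun hi hj => h'.edge i j hij v w ((hle i).2 hi) ((hle j).2 hj)
  · rw [hv, hv]
    exact Set.Subset.antisymm (fun v hv => h'.inter i j hij v hv.1 hv.2)
      (Set.subset_inter (h'.subset i) (h'.subset j))

lemma exists_connectedSystem_treeConnectivity [Finite V] {S : Finset V} (hS : 1 < S.card) :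
    ∃ H : Fin (treeConnectivity G S) → G.Subgraph, ConnectedSystem G (S : Set V) H := by
  have hne : {r : ℕ | ∃ T : Fin r → G.Subgraph, InternallyDisjointSTrees G S T}.Nonempty :=
    ⟨0, Fin.elim0, fun i => i.elim0, fun i => i.elim0⟩
  obtain ⟨T, hT⟩ := Nat.sSup_mem hne (bddAbove_internallyDisjointSTrees hS)
  exact ⟨T, hT.connectedSystem⟩

/-! ### Generalized connectivity and vertex connectivity -/

lemma genConnectivity_le {k : ℕ} [Finite V] {S : Finset V} (hS : S.card = k) :
    genConnectivity k G ≤ treeConnectivity G S := by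
  have := Fintype.ofFinite V
  have hk : k ≤ Nat.card V := by
    rw [Nat.card_eq_fintype_card, ← hS]
    exact Finset.card_le_univ S
  rw [genConnectivity, if_pos hk]
  exact Nat.sInf_le ⟨S, hS, rfl⟩

lemma le_genConnectivity {k t : ℕ} [Finite V] (hk : k ≤ Nat.card V)
    (h : ∀ S : Finset V, S.card = k → t ≤ treeConnectivity G S) : t ≤ genConnectivity k G := by
  have := Fintype.ofFinite V
  rw [genConnectivity, if_pos hk]
  obtain ⟨S, -, hS⟩ := Finset.exists_subset_card_eq (s := (Finset.univ : Finset V)) (n := k)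
    (by simpa [Nat.card_eq_fintype_card] using hk)
  refine le_csInf ⟨_, S, hS, rfl⟩ ?_
  rintro _ ⟨S, hS, rfl⟩
  exact h S hS

lemma exists_connectedSystem_of_card [Finite V] {k : ℕ} {S : Finset V} (hk : 1 < k)
    (hS : S.card = k) :
    ∃ H : Fin (genConnectivity k G) → G.Subgraph, ConnectedSystem G (S : Set V) H := by
  obtain ⟨H, hH⟩ := exists_connectedSystem_treeConnectivity (G := G) (S := S) (by lia)
  exact ⟨_, hH.comp (Fin.castLE_injective (genConnectivity_le hS))⟩

lemma vertexConnectivity_le {S : Finset V}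
    (hS : ¬ (G.induce ((S : Set V)ᶜ)).Preconnected ∨ ((S : Set V)ᶜ).Subsingleton) :
    vertexConnectivity G ≤ S.card :=
  Nat.sInf_le ⟨S, rfl, hS⟩

lemma vertexConnectivity_le_card [Fintype V] : vertexConnectivity G ≤ Fintype.card V :=
  vertexConnectivity_le (S := Finset.univ) (Or.inr (by simp))

lemma le_vertexConnectivity [Finite V] {t : ℕ}
    (h : ∀ S : Finset V, S.card < t →
      (G.induce ((S : Set V)ᶜ)).Preconnected ∧ ¬ ((S : Set V)ᶜ).Subsingleton) :
    t ≤ vertexConnectivity G := by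
  have := Fintype.ofFinite V
  refine le_csInf ⟨_, Finset.univ, rfl, Or.inr (by simp)⟩ ?_
  rintro _ ⟨S, rfl, hS⟩
  by_contra! hlt
  have := h S hlt
  tauto

lemma preconnected_induce_compl {X : Finset V} (hX : X.card < vertexConnectivity G) :
    (G.induce ((X : Set V)ᶜ)).Preconnected := by
  by_contra hX'
  exact absurd (vertexConnectivity_le (Or.inl hX')) (by lia)

/-- If fewer than `κ(G)` vertices are removed, every set of vertices that meets the rest and does
not contain all of it is left by an edge of the rest. -/
lemma exists_adj_of_card_lt {X : Finset V} (hX : X.card < vertexConnectivity G) (P : Set V)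
    {a b : V} (haX : a ∉ X) (hbX : b ∉ X) (ha : a ∈ P) (hb : b ∉ P) :
    ∃ x y, x ∉ X ∧ y ∉ X ∧ x ∈ P ∧ y ∉ P ∧ G.Adj x y := by
  obtain ⟨x, y, hx, hy, hxy⟩ := exists_adj_of_preconnected (preconnected_induce_compl hX)
    (Subtype.val ⁻¹' P) (a := ⟨a, haX⟩) (b := ⟨b, hbX⟩) ha hb
  exact ⟨x, y, x.2, y.2, hx, hy, hxy⟩

lemma preconnected_of_vertexConnectivity_pos (h : 0 < vertexConnectivity G) : G.Preconnected := by
  intro a b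
  by_contra hab
  obtain ⟨x, y, -, -, hx, hy, hxy⟩ := exists_adj_of_card_lt (X := ∅) (by simpa using h)
    {v | G.Reachable a v} (a := a) (b := b) (by simp) (by simp) (.refl a) hab
  exact hy (hx.trans hxy.reachable)

lemma vertexConnectivity_le_card_neighbors {x : V} {N : Finset V} (hxN : x ∉ N)
    (hN : ∀ w, G.Adj x w → w ∈ N) : vertexConnectivity G ≤ N.card := by
  by_contra! hlt
  by_cases hy : ∃ y, y ∉ N ∧ y ≠ x
  · obtain ⟨y, hyN, hyx⟩ := hy
    obtain ⟨p, q, -, hq, hp, -, hpq⟩ := exists_adj_of_card_lt hlt {x} hxN hyN rfl hyx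
    obtain rfl : p = x := hp
    exact hq (hN q hpq)
  · push Not at hy
    refine absurd (vertexConnectivity_le (G := G) (S := N) (Or.inr ?_)) (by lia)
    intro a ha b hb
    rw [hy a (by simpa using ha), hy b (by simpa using hb)]

/-! ### The fan lemma -/

/-- Hall's theorem yields an injective map that moves every vertex at distance at least two from `v`
to itself or to a neighbour, and never to a vertex of `U`. -/
lemma exists_injOn_map [Fintype V] (v : V) (U : Finset V) (hvU : v ∉ U)
    (hU : U.card ≤ vertexConnectivity G) :
    ∃ f : {w : V // w ≠ v ∧ ¬ G.Adj v w} → V, Function.Injective f ∧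
      ∀ w, f w ∉ U ∧ (f w = w ∨ G.Adj w (f w)) := by
  classical
  let N : {w : V // w ≠ v ∧ ¬ G.Adj v w} → Finset V := fun w =>
    Finset.univ.filter fun x => x ∉ U ∧ (x = w ∨ G.Adj w x)
  suffices ∀ W : Finset {w : V // w ≠ v ∧ ¬ G.Adj v w}, W.card ≤ (W.biUnion N).card by
    obtain ⟨f, hf, hfN⟩ := (Finset.all_card_le_biUnion_card_iff_exists_injective N).1 this
    exact ⟨f, hf, fun w => by simpa [N] using hfN w⟩
  intro W
  set W' : Finset V := W.map (Function.Embedding.subtype _) with hW'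
  -- the neighbours of `W'` outside `W'`
  set B : Finset V := Finset.univ.filter fun x => x ∉ W' ∧ ∃ w ∈ W', G.Adj w x with hB
  have hvW : v ∉ W' := by simp [hW']
  have hvB : v ∉ B := by
    simp only [hB, Finset.mem_filter, Finset.mem_univ, true_and, not_and, not_exists]
    rintro - w hw hwv
    simp only [hW', Finset.mem_map, Function.Embedding.subtype_apply, Subtype.exists,
      exists_and_right, exists_eq_right] at hw
    obtain ⟨⟨_, h⟩, _⟩ := hw
    exact h hwv.symm
  -- `U \ W' ∪ B` separates `v` from `U`
  have hsep : U.card ≤ ((U \ W') ∪ B).card := by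
    by_contra! hlt
    obtain ⟨u, huU, huX⟩ := Finset.exists_mem_notMem_of_card_lt_card hlt
    have huW : u ∈ W' := by
      by_contra h
      exact huX (Finset.mem_union_left _ (Finset.mem_sdiff.2 ⟨huU, h⟩))
    obtain ⟨x, y, hx, hy, hxW, hyW, hxy⟩ := exists_adj_of_card_lt (hlt.trans_le hU)
      (W' : Set V) (a := u) (b := v) huX (by simp [hvU, hvB]) huW hvW
    refine hy (Finset.mem_union_right _ ?_)
    simp only [hB, Finset.mem_filter, Finset.mem_univ, true_and]
    exact ⟨hyW, x, hxW, hxy⟩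
  have hsub : (W' \ U) ∪ (B \ U) ⊆ W.biUnion N := by
    intro x hx
    simp only [Finset.mem_union, Finset.mem_sdiff, hB, Finset.mem_filter, Finset.mem_univ,
      true_and, hW', Finset.mem_map, Function.Embedding.subtype_apply] at hx
    simp only [Finset.mem_biUnion, N, Finset.mem_filter, Finset.mem_univ, true_and]
    rcases hx with ⟨⟨w, hw, rfl⟩, hxU⟩ | ⟨⟨_, _, ⟨w, hw, rfl⟩, hwx⟩, hxU⟩
    · exact ⟨w, hw, hxU, Or.inl rfl⟩
    · exact ⟨w, hw, hxU, Or.inr hwx⟩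
  have hdisj : Disjoint (W' \ U) (B \ U) := by
    rw [Finset.disjoint_left]
    intro x hx hx'
    simp only [Finset.mem_sdiff, hB, Finset.mem_filter] at hx hx'
    exact hx'.1.2.1 hx.1
  have hsub2 : (U \ W') ∪ B ⊆ (U \ W') ∪ (B \ U) := by
    intro x hx
    simp only [Finset.mem_union, Finset.mem_sdiff, hB, Finset.mem_filter] at hx ⊢
    tauto
  have h1 := Finset.card_le_card hsub
  rw [Finset.card_union_of_disjoint hdisj] at h1
  have h2 := (hsep.trans (Finset.card_le_card hsub2)).trans (Finset.card_union_le _ _)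
  have h3 := Finset.card_sdiff_add_card_inter W' U
  have h4 := Finset.card_sdiff_add_card_inter U W'
  rw [Finset.inter_comm] at h4
  have h5 : W'.card = W.card := Finset.card_map _
  lia

/-- Fan lemma for sets: the vertices of a set `U` of at most `κ(G)` vertices are linked to a vertex
`v ∉ U` by connected subgraphs that share only `v`. Their vertices besides `v` are the orbits of
the elements of `U` under the map of `exists_injOn_map`. As the map is injective and misses `U`,
different orbits are disjoint and none is periodic, so that each of them reaches a neighbour
of `v`. -/
lemma exists_fan_finset [Fintype V] (v : V) (U : Finset V) (hvU : v ∉ U)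
    (hU : U.card ≤ vertexConnectivity G) :
    ∃ F : V → G.Subgraph, (∀ u ∈ U, (F u).Connected ∧ v ∈ (F u).verts ∧ u ∈ (F u).verts) ∧
      ∀ u ∈ U, ∀ u' ∈ U, u ≠ u' → ∀ x, x ∈ (F u).verts → x ∈ (F u').verts → x = v := by
  obtain ⟨f, hf, hfU⟩ := exists_injOn_map (G := G) v U hvU hU
  let R : V → V → Prop := fun a b => ∃ h, f ⟨a, h⟩ = b
  let O : V → Set V := fun u => {w | Relation.ReflTransGen R u w}
  have hRU : ∀ {a b}, R a b → b ∉ U := by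
    rintro a b ⟨h, rfl⟩
    exact (hfU _).1
  have hRv : ∀ {a b}, R a b → b ≠ v := by
    rintro a b ⟨h, rfl⟩ hv
    rcases (hfU ⟨a, h⟩).2 with h' | h'
    · exact h.1 (h'.symm.trans hv)
    · rw [hv] at h'
      exact h.2 h'.symm
  have hRinj : ∀ {a a' b}, R a b → R a' b → a = a' := by
    rintro a a' b ⟨h, hb⟩ ⟨h', hb'⟩
    simpa using hf (hb.trans hb'.symm)
  have hOv : ∀ u ∈ U, v ∉ O u := by
    intro u hu hv
    rcases Relation.ReflTransGen.cases_tail hv with h | ⟨c, -, hc⟩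
    · exact hvU (h ▸ hu)
    · exact hRv hc rfl
  have hOdisj : ∀ u ∈ U, ∀ u' ∈ U, ∀ x, x ∈ O u → x ∈ O u' → u = u' := by
    have hback : ∀ u ∈ U, ∀ a, Relation.ReflTransGen R a u → a = u := by
      intro u hu a ha
      rcases Relation.ReflTransGen.cases_tail ha with h | ⟨c, -, hc⟩
      · exact h.symm
      · exact absurd hu (hRU hc)
    intro u hu u' hu' x hx hx'
    induction hx with
    | refl => exact (hback u hu u' hx').symm
    | @tail b c hub hbc ih =>
      rcases Relation.ReflTransGen.cases_tail hx' with h | ⟨d, hd, hdc⟩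
      · exact absurd hu' (h ▸ hRU hbc)
      · exact ih (hRinj hdc hbc ▸ hd)
  have hOend : ∀ u ∈ U, ∃ w ∈ O u, G.Adj v w := by
    intro u hu
    by_contra! hno
    -- an orbit avoiding the neighbours of `v` would be permuted by `f`, so `f` would attain `u`
    have hdom : ∀ w : O u, (w : V) ≠ v ∧ ¬ G.Adj v w := fun w =>
      ⟨fun h => hOv u hu (h ▸ w.2), hno w w.2⟩
    let g : O u → O u := fun w =>
      ⟨f ⟨w, hdom w⟩, Relation.ReflTransGen.tail w.2 ⟨hdom w, rfl⟩⟩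
    have hg : Function.Injective g := by
      intro a b hab
      have := hf (congrArg Subtype.val hab)
      exact Subtype.ext (by simpa using this)
    obtain ⟨w, hw⟩ := Finite.surjective_of_injective hg ⟨u, Relation.ReflTransGen.refl⟩
    have hw' : f ⟨w, hdom w⟩ = u := congrArg Subtype.val hw
    exact (hfU ⟨w, hdom w⟩).1 (by rwa [hw'])
  refine ⟨fun u => (⊤ : G.Subgraph).induce (insert v (O u)), fun u hu => ⟨?_, ?_, ?_⟩, ?_⟩
  · have hreach : ∀ w ∈ O u, Relation.ReflTransGen
        ((⊤ : G.Subgraph).induce (insert v (O u))).Adj u w := by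
      intro w hw
      induction hw with
      | refl => exact .refl
      | @tail b c hub hbc ih =>
        obtain ⟨h, hb⟩ := hbc
        rcases (hfU ⟨b, h⟩).2 with h' | h'
        · rw [hb] at h'
          rw [h']
          exact ih
        · rw [hb] at h'
          refine ih.tail ?_
          simp only [SimpleGraph.Subgraph.induce_adj, SimpleGraph.Subgraph.top_adj]
          exact ⟨Or.inr hub, Or.inr (hub.tail ⟨h, hb⟩), h'⟩
    refine connected_of_reflTransGen (r := u) (Or.inr Relation.ReflTransGen.refl) ?_
    rintro w (rfl | hw)
    · obtain ⟨x, hx, hxw⟩ := hOend u hu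
      refine (hreach x hx).tail ?_
      simp only [SimpleGraph.Subgraph.induce_adj, SimpleGraph.Subgraph.top_adj]
      exact ⟨Or.inr hx, Or.inl rfl, hxw.symm⟩
    · exact hreach w hw
  · exact Or.inl rfl
  · exact Or.inr Relation.ReflTransGen.refl
  · rintro u hu u' hu' hne x (hx | hx) (hx' | hx')
    · exact hx
    · exact hx
    · exact hx'
    · exact absurd (hOdisj u hu u' hu' x hx hx') hne

/-- Fan lemma: `t ≤ κ(G)` distinct vertices are linked to a vertex `v`, which may be one of them, by
connected subgraphs that share only `v`. -/
lemma exists_fan [Finite V] {t : ℕ} (ht : t ≤ vertexConnectivity G) (v : V) {u : Fin t → V}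
    (hu : Function.Injective u) :
    ∃ F : Fin t → G.Subgraph, ConnectedSystem G {v} F ∧ ∀ a, u a ∈ (F a).verts := by
  classical
  have := Fintype.ofFinite V
  set U : Finset V := (Finset.univ.image u).erase v with hUdef
  have hcard : U.card ≤ vertexConnectivity G :=
    (Finset.card_erase_le.trans Finset.card_image_le).trans (by simpa using ht)
  obtain ⟨F, hF, hdisj⟩ := exists_fan_finset v U (by simp [hUdef]) hcard
  have hmem : ∀ a, u a ≠ v → u a ∈ U := fun a ha => by simp [hUdef, ha]
  set F' : Fin t → G.Subgraph := fun a => if u a = v then G.singletonSubgraph v else F (u a)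
    with hF'
  have h1 : ∀ a, u a = v → F' a = G.singletonSubgraph v := fun a ha => if_pos ha
  have h2 : ∀ a, u a ≠ v → F' a = F (u a) := fun a ha => if_neg ha
  have hinter : ∀ i j, i ≠ j → ∀ x, x ∈ (F' i).verts → x ∈ (F' j).verts → x = v := by
    intro i j hij x hi hj
    by_cases hiv : u i = v
    · rw [h1 i hiv] at hi
      simpa using hi
    by_cases hjv : u j = v
    · rw [h1 j hjv] at hj
      simpa using hj
    rw [h2 i hiv] at hi
    rw [h2 j hjv] at hj
    exact hdisj _ (hmem i hiv) _ (hmem j hjv) (hu.ne hij) x hi hj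
  refine ⟨F', ⟨fun i => ?_, fun i => ?_, hinter, fun i j hij x y hi hj => ?_⟩, fun a => ?_⟩
  · by_cases hiv : u i = v
    · rw [h1 i hiv]
      exact SimpleGraph.Subgraph.singletonSubgraph_connected
    · rw [h2 i hiv]
      exact (hF _ (hmem i hiv)).1
  · rw [Set.singleton_subset_iff]
    by_cases hiv : u i = v
    · simp [h1 i hiv]
    · rw [h2 i hiv]
      exact (hF _ (hmem i hiv)).2.1
  · have hx := hinter i j hij x ((F' i).edge_vert hi) ((F' j).edge_vert hj)
    have hy := hinter i j hij y ((F' i).edge_vert hi.symm) ((F' j).edge_vert hj.symm)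
    exact hi.adj_sub.ne (hx.trans hy.symm)
  · by_cases hav : u a = v
    · simp [h1 a hav, hav]
    · rw [h2 a hav]
      exact (hF _ (hmem a hav)).2.2

lemma exists_system_of_subsingleton [Finite V] {t : ℕ} (ht : t ≤ vertexConnectivity G) {A : Set V}
    (hA : A.Subsingleton) {u : Fin t → V} (hu : Function.Injective u) :
    ∃ F : Fin t → G.Subgraph, ConnectedSystem G A F ∧ ∀ a, u a ∈ (F a).verts := by
  rcases hA.eq_empty_or_singleton with rfl | ⟨v, rfl⟩
  · refine ⟨fun a => G.singletonSubgraph (u a), ⟨fun i =>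
      SimpleGraph.Subgraph.singletonSubgraph_connected, by simp, fun i j hij x hi hj => ?_,
      by simp⟩, by simp⟩
    simp only [SimpleGraph.singletonSubgraph_verts, Set.mem_singleton_iff] at hi hj
    exact hij (hu (hi.symm.trans hj))
  · exact exists_fan ht v hu

/-- Between two vertices `x` and `y` there are `t ≤ κ(G)` connected subgraphs that share neither an
edge nor a further vertex, with distinct representatives. They arise from a fan from `y` to `t`
vertices among `x` and its neighbours other than `y`, by joining these neighbours to `x`. -/
lemma exists_pair_system [Finite V] {t : ℕ} (ht : t ≤ vertexConnectivity G) {x y : V}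
    (hxy : x ≠ y) :
    ∃ (u : Fin t → V) (F : Fin t → G.Subgraph), Function.Injective u ∧
      ConnectedSystem G {x, y} F ∧ ∀ a, u a ∈ (F a).verts := by
  classical
  have := Fintype.ofFinite V
  set N : Finset V := Finset.univ.filter fun w => G.Adj x w with hN
  have hdeg : t ≤ N.card := ht.trans (vertexConnectivity_le_card_neighbors (x := x)
    (by simp [hN]) (by simp [hN]))
  have hxN : x ∉ N.erase y := by simp [hN]
  obtain ⟨U, hUsub, hU⟩ := Finset.exists_subset_card_eq (s := insert x (N.erase y)) (n := t) (by
    rw [Finset.card_insert_of_notMem hxN]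
    have := Finset.pred_card_le_card_erase (s := N) (a := y)
    lia)
  let e := U.equivFinOfCardEq hU
  set u : Fin t → V := fun a => e.symm a with hudef
  have hu : Function.Injective u := Subtype.val_injective.comp e.symm.injective
  have huU : ∀ a, u a = x ∨ (G.Adj x (u a) ∧ u a ≠ y) := by
    intro a
    have := hUsub (e.symm a).2
    simp only [Finset.mem_insert, Finset.mem_erase, hN, Finset.mem_filter, Finset.mem_univ,
      true_and] at this
    tauto
  obtain ⟨F, hF, huF⟩ := exists_fan ht y hu
  -- `F a` together with `x` and the edge from `x` to `u a`
  let P : Fin t → G.Subgraph := fun a =>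
    { verts := insert x (F a).verts
      Adj := fun p q => (F a).Adj p q ∨ (u a ≠ x ∧ (p = x ∧ q = u a ∨ p = u a ∧ q = x))
      adj_sub := by
        rintro p q (h | ⟨h, ⟨rfl, rfl⟩ | ⟨rfl, rfl⟩⟩)
        · exact h.adj_sub
        · exact ((huU a).resolve_left h).1
        · exact ((huU a).resolve_left h).1.symm
      edge_vert := by
        rintro p q (h | ⟨h, ⟨rfl, rfl⟩ | ⟨rfl, rfl⟩⟩)
        · exact Or.inr ((F a).edge_vert h)
        · exact Or.inl rfl
        · exact Or.inr (huF a)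
      symm := ⟨by
        rintro p q (h | ⟨h, h'⟩)
        · exact Or.inl h.symm
        · exact Or.inr ⟨h, by tauto⟩⟩ }
  have hinter : ∀ i j, i ≠ j → ∀ v, v ∈ (P i).verts → v ∈ (P j).verts →
      v ∈ ({x, y} : Set V) := by
    rintro i j hij v (hi | hi) (hj | hj)
    · exact Or.inl hi
    · exact Or.inl hi
    · exact Or.inl hj
    · exact Or.inr (hF.inter i j hij v hi hj)
  have hPxy : ∀ i, (P i).Adj x y → (F i).Adj x y := by
    rintro i (h | ⟨h, ⟨-, h'⟩ | ⟨-, h'⟩⟩)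
    · exact h
    · exact absurd h'.symm ((huU i).resolve_left h).2
    · exact absurd h'.symm hxy
  refine ⟨u, P, hu, ⟨fun i => ?_, fun i => ?_, hinter, fun i j hij p q hi hj => ?_⟩,
    fun a => Or.inr (huF a)⟩
  · refine connected_of_reflTransGen (r := u i) (Or.inr (huF i)) ?_
    rintro v (rfl | hv)
    · by_cases h : u i = v
      · rw [h]
      · exact .single (Or.inr ⟨h, Or.inr ⟨rfl, rfl⟩⟩)
    · exact Relation.ReflTransGen.mono (fun _ _ h => Or.inl h) _ _
        (reflTransGen_of_connected (hF.connected i) (huF i) hv)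
  · rintro v (rfl | rfl)
    · exact Or.inl rfl
    · exact Or.inr (hF.subset i rfl)
  · have hne := hi.adj_sub.ne
    have hp := hinter i j hij p ((P i).edge_vert hi) ((P j).edge_vert hj)
    have hq := hinter i j hij q ((P i).edge_vert hi.symm) ((P j).edge_vert hj.symm)
    rcases hp with rfl | rfl <;> rcases hq with rfl | rfl
    · exact hne rfl
    · exact hF.edge i j hij _ _ (hPxy i hi) (hPxy j hj)
    · exact hF.edge i j hij _ _ (hPxy i hi.symm) (hPxy j hj.symm)
    · exact hne rfl

/-! ### Lower bounds for Cartesian products -/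

/-- Systems in the layers of `G □ H` whose `a`-th members all contain `u a` are joined along the
columns over the vertices `u a`. -/
lemma exists_system_boxProd {ι : Type*} (hH : H.Connected) {S : Set (V × W)} {u : ι → V}
    (hu : Function.Injective u)
    (h : ∀ i : W, ∃ F : ι → G.Subgraph, ConnectedSystem G {g | (g, i) ∈ S} F ∧
      ∀ a, u a ∈ (F a).verts) :
    ∃ T : ι → (G.boxProd H).Subgraph, ConnectedSystem (G.boxProd H) S T := by
  choose F hF huF using h
  let T : ι → (G.boxProd H).Subgraph := fun a =>
    { verts := {p | p.1 ∈ (F p.2 a).verts}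
      Adj := fun p q => ((F p.2 a).Adj p.1 q.1 ∧ p.2 = q.2) ∨
        (H.Adj p.2 q.2 ∧ p.1 = u a ∧ q.1 = u a)
      adj_sub := by
        rintro p q (⟨h, h'⟩ | ⟨h, h', h''⟩)
        · exact Or.inl ⟨h.adj_sub, h'⟩
        · exact Or.inr ⟨h, h'.trans h''.symm⟩
      edge_vert := by
        rintro p q (⟨h, h'⟩ | ⟨h, h', h''⟩)
        · exact (F p.2 a).edge_vert h
        · rw [Set.mem_ofPred_eq, h']
          exact huF _ _
      symm := ⟨by
        rintro p q (⟨h, h'⟩ | ⟨h, h', h''⟩)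
        · exact Or.inl ⟨h' ▸ h.symm, h'.symm⟩
        · exact Or.inr ⟨h.symm, h'', h'⟩⟩ }
  refine ⟨T, fun a => ?_, ?_, ?_, ?_⟩
  · obtain ⟨i₀⟩ := hH.nonempty
    refine connected_of_reflTransGen (r := (u a, i₀)) (huF i₀ a) ?_
    rintro ⟨g, i⟩ hg
    have h1 : Relation.ReflTransGen (T a).Adj (u a, i₀) (u a, i) :=
      Relation.ReflTransGen.lift (fun j => (u a, j)) (fun j j' hj => Or.inr ⟨hj, rfl, rfl⟩) _ _
        ((SimpleGraph.reachable_iff_reflTransGen _ _).1 (hH.preconnected i₀ i))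
    have h2 : Relation.ReflTransGen (T a).Adj (u a, i) (g, i) :=
      Relation.ReflTransGen.lift (fun g => (g, i)) (fun g g' hg => Or.inl ⟨hg, rfl⟩) _ _
        (reflTransGen_of_connected ((hF i).connected a) (huF i a) hg)
    exact h1.trans h2
  · rintro a ⟨g, i⟩ hg
    exact (hF i).subset a hg
  · rintro a b hab ⟨g, i⟩ ha hb
    exact (hF i).inter a b hab g ha hb
  · rintro a b hab ⟨g, i⟩ ⟨g', i'⟩ (⟨ha, ha'⟩ | ⟨ha, ha', ha''⟩) (⟨hb, hb'⟩ | ⟨hb, hb', hb''⟩)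
    · exact (hF i).edge a b hab g g' ha hb
    · exact hb.ne ha'
    · exact ha.ne hb'
    · exact hab (hu (ha'.symm.trans hb'))

/-- Three vertices of `G □ H` that do not lie in one layer are joined by `κ(G)` internally disjoint
trees. At most one layer contains two of them; that layer determines the columns used. -/
lemma le_treeConnectivity_boxProd_of_not_layer [Finite V] [Finite W] (hH : H.Connected)
    {S : Finset (V × W)} (hS : S.card = 3) (hlayer : ¬ ∃ i, ∀ p ∈ S, p.2 = i) :
    vertexConnectivity G ≤ treeConnectivity (G.boxProd H) S := by
  classical
  have := Fintype.ofFinite V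
  suffices ∃ u : Fin (vertexConnectivity G) → V, Function.Injective u ∧ ∀ i : W,
      ∃ F : Fin (vertexConnectivity G) → G.Subgraph,
        ConnectedSystem G {g | (g, i) ∈ (S : Set (V × W))} F ∧ ∀ a, u a ∈ (F a).verts by
    obtain ⟨u, hu, h⟩ := this
    obtain ⟨T, hT⟩ := exists_system_boxProd hH hu h
    simpa using hT.le_treeConnectivity (by lia)
  by_cases hsub : ∀ i, {g | (g, i) ∈ (S : Set (V × W))}.Subsingleton
  · obtain ⟨u⟩ : Nonempty (Fin (vertexConnectivity G) ↪ V) :=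
      Function.Embedding.nonempty_of_card_le (by simpa using vertexConnectivity_le_card)
    exact ⟨u, u.injective, fun i => exists_system_of_subsingleton le_rfl (hsub i) u.injective⟩
  · push Not at hsub
    obtain ⟨i, x, hx, y, hy, hxy⟩ := hsub
    simp only [Set.mem_ofPred_eq, Finset.mem_coe] at hx hy
    obtain ⟨⟨z, j⟩, hz, hji⟩ : ∃ p ∈ S, p.2 ≠ i := by
      by_contra! h
      exact hlayer ⟨i, h⟩
    simp only at hji
    have hSeq : S = {(x, i), (y, i), (z, j)} := by
      symm
      refine Finset.eq_of_subset_of_card_le (by simp [Finset.insert_subset_iff, hx, hy, hz]) ?_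
      rw [hS, Finset.card_eq_three.2 ⟨_, _, _, ?_, ?_, ?_, rfl⟩] <;> grind
    obtain ⟨u, F, hu, hF, huF⟩ := exists_pair_system (G := G) le_rfl hxy
    refine ⟨u, hu, fun l => ?_⟩
    by_cases hl : l = i
    · refine ⟨F, ?_, huF⟩
      have : {g | (g, l) ∈ (S : Set (V × W))} = {x, y} := by
        ext g
        simp [hSeq, hl, hji.symm]
      rwa [this]
    · refine exists_system_of_subsingleton le_rfl ?_ hu
      intro g hg g' hg'
      simp only [hSeq, Finset.coe_insert, Finset.coe_singleton, Set.mem_ofPred_eq,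
        Set.mem_insert_iff, Prod.mk.injEq, hl, and_false, Set.mem_singleton_iff, false_or] at hg hg'
      exact hg.1.trans hg'.1.symm

/-- The copy in the layer over `i` of a subgraph of `G`. -/
def layerSubgraph (H : SimpleGraph W) (i : W) (F : G.Subgraph) : (G.boxProd H).Subgraph where
  verts := {p | p.1 ∈ F.verts ∧ p.2 = i}
  Adj p q := F.Adj p.1 q.1 ∧ p.2 = i ∧ q.2 = i
  adj_sub := fun ⟨h, hp, hq⟩ => Or.inl ⟨h.adj_sub, hp.trans hq.symm⟩
  edge_vert := fun ⟨h, hp, _⟩ => ⟨F.edge_vert h, hp⟩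
  symm := ⟨fun _ _ ⟨h, hp, hq⟩ => ⟨h.symm, hq, hp⟩⟩

/-- Systems are carried over to the layers of `G □ H`. -/
lemma ConnectedSystem.layer {ι : Type*} {A : Set V} {F : ι → G.Subgraph}
    (h : ConnectedSystem G A F) (H : SimpleGraph W) (i : W) :
    ConnectedSystem (G.boxProd H) {p | p.1 ∈ A ∧ p.2 = i}
      fun a => layerSubgraph H i (F a) := by
  refine ⟨fun a => ?_, fun a p hp => ⟨h.subset a hp.1, hp.2⟩,
    fun a b hab p ha hb => ⟨h.inter a b hab _ ha.1 hb.1, ha.2⟩,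
    fun a b hab p q ha hb => h.edge a b hab _ _ ha.1 hb.1⟩
  obtain ⟨r, hr⟩ := (h.connected a).nonempty
  refine connected_of_reflTransGen (r := (r, i)) ⟨hr, rfl⟩ ?_
  rintro ⟨g, j⟩ ⟨hg, rfl⟩
  exact Relation.ReflTransGen.lift (fun g => (g, j)) (fun g g' hg => ⟨hg, rfl, rfl⟩) _ _
    (reflTransGen_of_connected (h.connected a) hr hg)

/-- The layer over `j` together with the edges of `G □ H` that join it to the copy of `A` in a
neighbouring layer. -/
def layerWithLegs (G : SimpleGraph V) {i j : W} (hij : H.Adj i j) (A : Set V) :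
    (G.boxProd H).Subgraph where
  verts := {p | p.2 = j ∨ p.1 ∈ A ∧ p.2 = i}
  Adj p q := (G.Adj p.1 q.1 ∧ p.2 = j ∧ q.2 = j) ∨
    (p.1 = q.1 ∧ p.1 ∈ A ∧ (p.2 = i ∧ q.2 = j ∨ p.2 = j ∧ q.2 = i))
  adj_sub := by
    rintro ⟨g, p⟩ ⟨g', q⟩ (⟨h, rfl, h'⟩ | ⟨h, -, ⟨rfl, rfl⟩ | ⟨rfl, rfl⟩⟩)
    · exact Or.inl ⟨h, h'.symm⟩
    · exact Or.inr ⟨hij, h⟩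
    · exact Or.inr ⟨hij.symm, h⟩
  edge_vert := by
    rintro p q (⟨h, h', -⟩ | ⟨h, hA, ⟨h', -⟩ | ⟨h', -⟩⟩)
    · exact Or.inl h'
    · exact Or.inr ⟨hA, h'⟩
    · exact Or.inl h'
  symm := ⟨by
    rintro p q (⟨h, hp, hq⟩ | ⟨h, hA, h'⟩)
    · exact Or.inl ⟨h.symm, hq, hp⟩
    · exact Or.inr ⟨h.symm, h ▸ hA, by tauto⟩⟩

lemma layerWithLegs_connected (hG : G.Connected) {i j : W} (hij : H.Adj i j) (A : Set V) :
    (layerWithLegs G hij A).Connected := by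
  obtain ⟨r⟩ := hG.nonempty
  have hreach : ∀ g, Relation.ReflTransGen (layerWithLegs G hij A).Adj (r, j) (g, j) := fun g =>
    Relation.ReflTransGen.lift (fun g => (g, j)) (fun g g' hg => Or.inl ⟨hg, rfl, rfl⟩) _ _
      ((SimpleGraph.reachable_iff_reflTransGen _ _).1 (hG.preconnected r g))
  refine connected_of_reflTransGen (r := (r, j)) (Or.inl rfl) ?_
  rintro ⟨g, l⟩ (hl | ⟨hg, hl⟩)
  · simp only at hl
    rw [hl]
    exact hreach g
  · exact (hreach g).tail (Or.inr ⟨rfl, hg, Or.inr ⟨rfl, hl⟩⟩)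

/-- In a layer that has a neighbouring layer, a system through vertices of the layer admits one more
member, which passes through the neighbouring layer. -/
lemma ConnectedSystem.exists_layer_succ {ι : Type*} {A : Set V} {F : ι → G.Subgraph}
    (h : ConnectedSystem G A F) (hG : G.Connected) {i j : W} (hij : H.Adj i j) :
    ∃ T : Option ι → (G.boxProd H).Subgraph,
      ConnectedSystem (G.boxProd H) {p | p.1 ∈ A ∧ p.2 = i} T := by
  have hL := h.layer H i
  refine ⟨fun a => a.elim (layerWithLegs G hij A) fun a => layerSubgraph H i (F a), ?_, ?_, ?_, ?_⟩
  · rintro (_ | a)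
    · exact layerWithLegs_connected hG hij A
    · exact hL.connected a
  · rintro (_ | a)
    · exact fun p hp => Or.inr hp
    · exact hL.subset a
  · rintro (_ | a) (_ | b) hab p ha hb
    · exact absurd rfl hab
    · exact ha.resolve_left fun h => hij.ne (hb.2.symm.trans h)
    · exact hb.resolve_left fun h => hij.ne (ha.2.symm.trans h)
    · exact hL.inter a b (fun h => hab (congrArg some h)) p ha hb
  · have aux : ∀ a p q, (layerWithLegs G hij A).Adj p q →
        ¬ (layerSubgraph H i (F a)).Adj p q := by
      rintro a p q (⟨-, h1, -⟩ | ⟨-, -, ⟨-, h1⟩ | ⟨h1, -⟩⟩) ⟨-, h2, h3⟩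
      · exact hij.ne (h2.symm.trans h1)
      · exact hij.ne (h3.symm.trans h1)
      · exact hij.ne (h2.symm.trans h1)
    rintro (_ | a) (_ | b) hab p q ha hb
    · exact absurd rfl hab
    · exact aux b p q ha hb
    · exact aux a p q hb ha
    · exact hL.edge a b (fun h => hab (congrArg some h)) p q ha hb

lemma exists_eq_layer {S : Finset (V × W)} {i : W} (h : ∀ p ∈ S, p.2 = i) :
    ∃ A : Finset V, A.card = S.card ∧ (S : Set (V × W)) = {p | p.1 ∈ (A : Set V) ∧ p.2 = i} := by
  classical
  refine ⟨S.image Prod.fst, Finset.card_image_of_injOn fun p hp q hq hpq =>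
    Prod.ext hpq ((h p hp).trans (h q hq).symm), ?_⟩
  ext ⟨g, j⟩
  simp only [Finset.mem_coe, Finset.coe_image, Set.mem_image, Prod.exists, exists_and_right,
    exists_eq_right, Set.mem_ofPred_eq]
  constructor
  · exact fun hg => ⟨⟨j, hg⟩, h _ hg⟩
  · rintro ⟨⟨l, hl⟩, rfl⟩
    obtain rfl : l = j := h _ hl
    exact hl

lemma genConnectivity_le_boxProd [Finite V] [Finite W] (hH : H.Connected)
    (h : genConnectivity 3 G = vertexConnectivity G) (hpos : 1 ≤ vertexConnectivity G) :
    genConnectivity 3 G ≤ genConnectivity 3 (G.boxProd H) := by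
  by_cases hcard : 3 ≤ Nat.card (V × W)
  · refine le_genConnectivity hcard fun S hS => ?_
    by_cases hlayer : ∃ i, ∀ p ∈ S, p.2 = i
    · obtain ⟨i, hi⟩ := hlayer
      obtain ⟨A, hA, hSA⟩ := exists_eq_layer hi
      obtain ⟨F, hF⟩ := exists_connectedSystem_of_card (G := G) (S := A) (k := 3) (by lia)
        (hA.trans hS)
      have hT := hF.layer H i
      rw [← hSA] at hT
      simpa using hT.le_treeConnectivity (by lia)
    · rw [h]
      exact le_treeConnectivity_boxProd_of_not_layer hH hS hlayer
  · have hV : Nonempty V := by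
      by_contra hV
      rw [not_nonempty_iff] at hV
      have := vertexConnectivity_le (G := G) (S := ∅) (Or.inr (Set.subsingleton_of_subsingleton))
      simp at this
      lia
    have hW := hH.nonempty
    have hG : G.Connected := (SimpleGraph.connected_iff _).2
      ⟨preconnected_of_vertexConnectivity_pos hpos, hV⟩
    have hcardV : ¬ 3 ≤ Nat.card V := by
      intro h3
      rw [Nat.card_prod] at hcard
      exact hcard (h3.trans (Nat.le_mul_of_pos_right _ Nat.card_pos))
    simp only [genConnectivity, if_neg hcard, if_neg hcardV, if_pos hG, if_pos (hG.boxProd hH),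
      le_refl]

lemma genConnectivity_succ_le_boxProd [Finite V] [Finite W] [Nontrivial W] (hH : H.Connected)
    (hpos : 1 ≤ genConnectivity 3 G) (h : genConnectivity 3 G < vertexConnectivity G) :
    genConnectivity 3 G + 1 ≤ genConnectivity 3 (G.boxProd H) := by
  have := Fintype.ofFinite V
  have hV := vertexConnectivity_le_card (G := G)
  have hVne : Nonempty V := Fintype.card_pos_iff.1 (by lia)
  have hG : G.Connected := (SimpleGraph.connected_iff _).2
    ⟨preconnected_of_vertexConnectivity_pos (by lia), hVne⟩
  have hW : 1 < Nat.card W := Finite.one_lt_card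
  have hcard : 3 ≤ Nat.card (V × W) := by
    rw [Nat.card_prod, Nat.card_eq_fintype_card]
    nlinarith
  refine le_genConnectivity hcard fun S hS => ?_
  by_cases hlayer : ∃ i, ∀ p ∈ S, p.2 = i
  · obtain ⟨i, hi⟩ := hlayer
    obtain ⟨A, hA, hSA⟩ := exists_eq_layer hi
    obtain ⟨F, hF⟩ := exists_connectedSystem_of_card (G := G) (S := A) (k := 3) (by lia)
      (hA.trans hS)
    obtain ⟨j, hij⟩ := hH.preconnected.exists_adj_of_nontrivial i
    obtain ⟨T, hT⟩ := hF.exists_layer_succ hG hij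
    rw [← hSA] at hT
    simpa using hT.le_treeConnectivity (by lia)
  · exact h.trans_le (le_treeConnectivity_boxProd_of_not_layer hH hS hlayer)

/-! ### Upper bounds from degrees -/

lemma treeConnectivity_le_of_card_le [Finite V] {S : Finset V} {d : ℕ} (hS : 1 < S.card)
    (h : ∀ (r : ℕ) (H : Fin r → G.Subgraph), ConnectedSystem G (S : Set V) H → r ≤ d) :
    treeConnectivity G S ≤ d := by
  obtain ⟨H, hH⟩ := exists_connectedSystem_treeConnectivity (G := G) hS
  exact h _ H hH

/-- `κ₃(G)` is at most the degree of any vertex. -/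
lemma genConnectivity_le_card_neighbors [Finite V] (hV : 3 ≤ Nat.card V) {s : V} (N : Finset V)
    (hN : ∀ w, G.Adj s w → w ∈ N) : genConnectivity 3 G ≤ N.card := by
  classical
  have := Fintype.ofFinite V
  obtain ⟨S, hsS, -, hS⟩ := Finset.exists_subsuperset_card_eq (s := {s}) (t := Finset.univ)
    (n := 3) (Finset.subset_univ _) (by simp) (by simpa [Nat.card_eq_fintype_card] using hV)
  have hs : s ∈ S := by simpa using hsS
  obtain ⟨s', hs', hne⟩ := Finset.exists_mem_ne (s := S) (by lia) s
  refine (genConnectivity_le hS).trans (treeConnectivity_le_of_card_le (by lia) fun r H hH => ?_)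
  simpa using hH.card_le_of_mem hs hs' hne N hN

/-- If two adjacent vertices have at most `d` further neighbours each, then `κ₃(G) ≤ d`. -/
lemma genConnectivity_le_of_adj [Finite V] (hV : 3 ≤ Nat.card V) {a b : V} (hab : a ≠ b) {d : ℕ}
    (Na Nb : Finset V) (hNa : ∀ w, G.Adj a w → w ≠ b → w ∈ Na)
    (hNb : ∀ w, G.Adj b w → w ≠ a → w ∈ Nb) (hda : Na.card ≤ d) (hdb : Nb.card ≤ d) :
    genConnectivity 3 G ≤ d := by
  classical
  have := Fintype.ofFinite V
  obtain ⟨c, -, hc⟩ := Finset.exists_mem_notMem_of_card_lt_card (s := {a, b}) (t := Finset.univ)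
    (by
      rw [Finset.card_pair hab, Finset.card_univ, ← Nat.card_eq_fintype_card]
      exact hV)
  simp only [Finset.mem_insert, Finset.mem_singleton, not_or] at hc
  have hS : ({a, b, c} : Finset V).card = 3 :=
    Finset.card_eq_three.2 ⟨a, b, c, hab, Ne.symm hc.1, Ne.symm hc.2, rfl⟩
  refine (genConnectivity_le hS).trans (treeConnectivity_le_of_card_le (by lia) fun r H hH => ?_)
  simpa using hH.card_le_of_adj (a := a) (b := b) (c := c) (by simp) (by simp) (by simp) hab hc.1
    hc.2 Na Nb hNa hNb hda hdb

/-- The two copies of a vertex of `G` are adjacent in `G □ P₂`, which bounds `κ₃(G □ P₂)` by the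
minimum degree of `G`. -/
lemma genConnectivity_boxProd_pathGraph_two_le [Finite V] (hV : 2 ≤ Nat.card V) {s : V}
    (N : Finset V) (hN : ∀ w, G.Adj s w → w ∈ N) :
    genConnectivity 3 (G.boxProd (SimpleGraph.pathGraph 2)) ≤ N.card := by
  classical
  have hcard : 3 ≤ Nat.card (V × Fin 2) := by
    rw [Nat.card_prod]
    simp
    lia
  have aux : ∀ i j : Fin 2, i ≠ j → ∀ w, (G.boxProd (SimpleGraph.pathGraph 2)).Adj (s, i) w →
      w ≠ (s, j) → w ∈ N.image fun g => (g, i) := by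
    rintro i j hij ⟨g, l⟩ (⟨h, h'⟩ | ⟨h, h'⟩) hne
    · simp only at h h'
      simp [hN g h, h']
    · simp only at h h'
      have hil := h.ne
      obtain rfl : l = j := by lia
      exact absurd (by rw [h']) hne
  exact genConnectivity_le_of_adj hcard (a := (s, 0)) (b := (s, 1)) (by simp)
    (N.image fun g => (g, 0)) (N.image fun g => (g, 1)) (aux 0 1 (by simp)) (aux 1 0 (by simp))
    Finset.card_image_le Finset.card_image_le

/-! ### Complete graphs -/

/-- If every set of fewer than `t` vertices misses a vertex that is adjacent to all others, and `G`
has more than `t` vertices, then `κ(G) ≥ t`. -/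
lemma le_vertexConnectivity_of_universal [Fintype V] {t : ℕ} (ht : t < Fintype.card V)
    (h : ∀ S : Finset V, S.card < t → ∃ c ∉ S, ∀ v, v ≠ c → G.Adj c v) :
    t ≤ vertexConnectivity G := by
  classical
  refine le_vertexConnectivity fun S hS => ?_
  obtain ⟨c, hcS, hc⟩ := h S hS
  constructor
  · have key : ∀ v : ((S : Set V)ᶜ : Set V),
        (G.induce ((S : Set V)ᶜ)).Reachable ⟨c, hcS⟩ v := by
      rintro ⟨v, hv⟩
      by_cases hvc : v = c
      · subst hvc
        exact .refl _
      · exact SimpleGraph.Adj.reachable (by simpa using hc v hvc)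
    exact fun a b => (key a).symm.trans (key b)
  · intro hsub
    obtain ⟨d, -, hd⟩ := Finset.exists_mem_notMem_of_card_lt_card (s := insert c S)
      (t := Finset.univ) (by
        have := Finset.card_insert_le c S
        rw [Finset.card_univ]
        lia)
    simp only [Finset.mem_insert, not_or] at hd
    exact hd.1 (hsub (by simpa using hd.2) (by simpa using hcS))

/-- The star with centre `c` and all vertices of `S` as further vertices. -/
def starSubgraph (G : SimpleGraph V) (S : Set V) (c : V) (hc : ∀ v ∈ S, v ≠ c → G.Adj c v) :
    G.Subgraph where
  verts := insert c S
  Adj p q := p ≠ q ∧ (p = c ∧ q ∈ S ∨ q = c ∧ p ∈ S)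
  adj_sub := by
    rintro p q ⟨h, ⟨rfl, hq⟩ | ⟨rfl, hp⟩⟩
    · exact hc q hq h.symm
    · exact (hc p hp h).symm
  edge_vert := by
    rintro p q ⟨h, ⟨rfl, hq⟩ | ⟨rfl, hp⟩⟩
    · exact Or.inl rfl
    · exact Or.inr hp
  symm := ⟨by
    rintro p q ⟨h, h'⟩
    exact ⟨h.symm, h'.symm⟩⟩

lemma starSubgraph_connected (S : Set V) (c : V) (hc : ∀ v ∈ S, v ≠ c → G.Adj c v) :
    (starSubgraph G S c hc).Connected := by
  refine connected_of_reflTransGen (r := c) (Or.inl rfl) ?_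
  intro v hv
  by_cases hvc : v = c
  · rw [hvc]
  · exact .single ⟨Ne.symm hvc, Or.inl ⟨rfl, hv.resolve_left hvc⟩⟩

/-- In a complete graph, the stars with leaves `S` and centre outside `S`, together with one star
whose centre lies in `S`, form a system through `S`. -/
lemma le_genConnectivity_top (k : ℕ) (hk : 1 ≤ k) :
    k ≤ genConnectivity 3 (⊤ : SimpleGraph (Fin (k + 2))) := by
  refine le_genConnectivity (by simp; lia) fun S hS => ?_
  obtain ⟨s, hs⟩ : S.Nonempty := Finset.card_pos.1 (by lia)
  let T : Option {c // c ∉ S} → (⊤ : SimpleGraph (Fin (k + 2))).Subgraph := fun a =>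
    starSubgraph ⊤ S (a.elim s (·.1)) fun v _ h => by simpa using h.symm
  have hT : ConnectedSystem ⊤ (S : Set (Fin (k + 2))) T := by
    refine ⟨fun a => starSubgraph_connected _ _ _, fun a => Set.subset_insert _ _, ?_, ?_⟩
    · rintro (_ | a) (_ | b) hab v ha hb
      · exact absurd rfl hab
      · exact ha.elim (fun h => h ▸ hs) id
      · exact hb.elim (fun h => h ▸ hs) id
      · rcases ha with ha | ha
        · rcases hb with hb | hb
          · exact absurd (congrArg some (Subtype.ext (ha.symm.trans hb))) hab
          · exact hb
        · exact ha
    · rintro (_ | ⟨a, ha⟩) (_ | ⟨b, hb⟩) hab v w ⟨-, h1⟩ ⟨-, h2⟩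
      · exact absurd rfl hab
      all_goals
        simp only [Option.elim, Finset.mem_coe] at h1 h2
        grind
  have := hT.le_treeConnectivity (by lia)
  have hc : Fintype.card {c // c ∉ S} = k + 2 - 3 := by
    rw [Fintype.card_subtype_compl]
    simp [hS]
  rw [Fintype.card_option, hc] at this
  lia

lemma card_compl_zero (k : ℕ) : ({0}ᶜ : Finset (Fin (k + 2))).card = k + 1 := by
  rw [Finset.card_compl]
  simp

lemma genConnectivity_top (k : ℕ) (hk : 1 ≤ k) :
    genConnectivity 3 (⊤ : SimpleGraph (Fin (k + 2))) = k := by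
  refine le_antisymm ?_ (le_genConnectivity_top k hk)
  have hcard : (Finset.univ \ {0, 1} : Finset (Fin (k + 2))).card ≤ k := by
    rw [Finset.card_univ_sdiff, Finset.card_pair (by simp)]
    simp
  refine genConnectivity_le_of_adj (by simp; lia) (a := 0) (b := 1) (by simp)
    (Finset.univ \ {0, 1}) (Finset.univ \ {0, 1}) ?_ ?_ hcard hcard
  · intro w h h'
    simp [h.ne.symm, h']
  · intro w h h'
    simp [h.ne.symm, h']

lemma lt_vertexConnectivity_top (k : ℕ) :
    k < vertexConnectivity (⊤ : SimpleGraph (Fin (k + 2))) := by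
  refine le_vertexConnectivity_of_universal (by simp) fun S hS => ?_
  obtain ⟨c, -, hc⟩ := Finset.exists_mem_notMem_of_card_lt_card (s := S) (t := Finset.univ)
    (by simp; lia)
  exact ⟨c, hc, fun v hv => hv.symm⟩

/-! ### Complete split graphs -/

/-- The complete split graph with a clique of `k` universal vertices and three further, pairwise
non-adjacent vertices. -/
def splitGraph (k : ℕ) : SimpleGraph (Fin (k + 3)) where
  Adj i j := i ≠ j ∧ ((i : ℕ) < k ∨ (j : ℕ) < k)
  symm := ⟨fun _ _ h => ⟨h.1.symm, h.2.symm⟩⟩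
  loopless := ⟨fun _ h => h.1 rfl⟩

/-- The clique vertices of `splitGraph k`. -/
def splitClique (k : ℕ) : Finset (Fin (k + 3)) := Finset.univ.filter fun i => (i : ℕ) < k

lemma mem_splitClique {k : ℕ} {i : Fin (k + 3)} : i ∈ splitClique k ↔ (i : ℕ) < k := by
  simp [splitClique]

lemma card_splitClique (k : ℕ) : (splitClique k).card = k := by
  rw [splitClique, Fin.card_filter_val_lt]
  simp

lemma adj_last_splitGraph {k : ℕ} (w : Fin (k + 3))
    (h : (splitGraph k).Adj (Fin.last (k + 2)) w) : w ∈ splitClique k := by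
  rcases h with ⟨-, h | h⟩
  · simp at h
  · exact mem_splitClique.2 h

lemma vertexConnectivity_splitGraph (k : ℕ) : vertexConnectivity (splitGraph k) = k := by
  refine le_antisymm ?_ (le_vertexConnectivity_of_universal (by simp) fun S hS => ?_)
  · have h := vertexConnectivity_le_card_neighbors (G := splitGraph k) (x := Fin.last (k + 2))
      (N := splitClique k) (by simp [mem_splitClique]) adj_last_splitGraph
    rwa [card_splitClique] at h
  · obtain ⟨c, hc, hcS⟩ := Finset.exists_mem_notMem_of_card_lt_card
      (hS.trans_eq (card_splitClique k).symm)
    exact ⟨c, hcS, fun v hv => ⟨hv.symm, Or.inl (mem_splitClique.1 hc)⟩⟩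

/-- For every clique vertex `c` there is a tree through three given vertices `S`: the star with
centre `c` and leaves `S` if `c ∉ S`. If `c ∈ S`, then `c` is joined to the independent vertices of
`S`, and all clique vertices of `S` are joined to an independent vertex outside `S` reserved
for `c`. -/
lemma le_genConnectivity_splitGraph (k : ℕ) : k ≤ genConnectivity 3 (splitGraph k) := by
  refine le_genConnectivity (by simp) fun S hS => ?_
  set C := splitClique k with hC
  -- `w c` is the independent vertex reserved for `c`
  obtain ⟨w, hw⟩ : ∃ w : (S ∩ C : Finset _) → Fin (k + 3), Function.Injective w ∧
      ∀ c, w c ∉ S ∧ w c ∉ C := by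
    have hle : (S ∩ C).card ≤ ((Finset.univ \ C) \ S).card := by
      have h1 := Finset.card_inter_add_card_sdiff S C
      have h2 := Finset.card_sdiff_add_card_inter (Finset.univ \ C) S
      have h3 : (Finset.univ \ C).card = 3 := by
        rw [Finset.card_univ_sdiff, card_splitClique]
        simp
      have h4 : (Finset.univ \ C) ∩ S = S \ C := by grind
      rw [h4] at h2
      lia
    obtain ⟨e⟩ := Function.Embedding.nonempty_of_card_le (α := (S ∩ C : Finset _))
      (β := ((Finset.univ \ C) \ S : Finset _)) (by rwa [Fintype.card_coe, Fintype.card_coe])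
    refine ⟨fun c => e c, Subtype.val_injective.comp e.injective, fun c => ?_⟩
    have := (e c).2
    simp only [Finset.mem_sdiff, Finset.mem_univ, true_and] at this
    exact ⟨this.2, this.1⟩
  obtain ⟨hwinj, hw⟩ := hw
  have hadj : ∀ {p q}, p ∈ C → p ≠ q → (splitGraph k).Adj p q := fun hp hne =>
    ⟨hne, Or.inl (mem_splitClique.1 hp)⟩
  -- the vertex of the `c`-th tree outside `S`
  let x : C → Fin (k + 3) := fun c =>
    if h : (c : Fin (k + 3)) ∈ S then w ⟨c, Finset.mem_inter.2 ⟨h, c.2⟩⟩ else c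
  have hx₁ : ∀ c : C, ∀ h : c.1 ∈ S, x c = w ⟨c, Finset.mem_inter.2 ⟨h, c.2⟩⟩ :=
    fun c h => dif_pos h
  have hx₂ : ∀ c : C, c.1 ∉ S → x c = c := fun c h => dif_neg h
  have hxS : ∀ c, x c ∉ S := by
    intro c
    by_cases h : c.1 ∈ S
    · rw [hx₁ c h]
      exact (hw _).1
    · rwa [hx₂ c h]
  have hxinj : Function.Injective x := by
    intro c d hcd
    by_cases hc : c.1 ∈ S <;> by_cases hd : d.1 ∈ S
    · rw [hx₁ c hc, hx₁ d hd] at hcd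
      have := congrArg Subtype.val (hwinj hcd)
      exact Subtype.ext this
    · rw [hx₁ c hc, hx₂ d hd] at hcd
      exact absurd d.2 (hcd ▸ (hw _).2)
    · rw [hx₂ c hc, hx₁ d hd] at hcd
      exact absurd c.2 (hcd ▸ (hw _).2)
    · rw [hx₂ c hc, hx₂ d hd] at hcd
      exact Subtype.ext hcd
  -- half of the edge relation of the `c`-th tree
  let E : C → Fin (k + 3) → Fin (k + 3) → Prop := fun c p q =>
    (p = x c ∧ q ∈ S ∧ (c.1 ∉ S ∨ q ∈ C)) ∨ (p = c.1 ∧ p ∈ S ∧ q ∈ S ∧ q ∉ C)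
  have hE : ∀ c p q, E c p q → (splitGraph k).Adj p q := by
    rintro c p q (⟨rfl, hq, h⟩ | ⟨rfl, hp, hq, hqC⟩)
    · have hne : x c ≠ q := fun h => hxS c (h ▸ hq)
      rcases h with h | h
      · refine hadj ?_ hne
        rw [hx₂ c h]
        exact c.2
      · exact (hadj h hne.symm).symm
    · exact hadj c.2 fun h => hqC (h ▸ c.2)
  let T : C → (splitGraph k).Subgraph := fun c =>
    { verts := insert (x c) S
      Adj := fun p q => E c p q ∨ E c q p
      adj_sub := by
        rintro p q (h | h)
        · exact hE c p q h
        · exact (hE c q p h).symm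
      edge_vert := by
        rintro p q ((⟨rfl, -, -⟩ | ⟨-, h, -⟩) | (⟨-, h, -⟩ | ⟨-, -, h, -⟩))
        · exact Or.inl rfl
        · exact Or.inr h
        · exact Or.inr h
        · exact Or.inr h
      symm := ⟨fun _ _ h => h.symm⟩ }
  have hT : ConnectedSystem (splitGraph k) (S : Set (Fin (k + 3))) T := by
    refine ⟨fun c => ?_, fun c => Set.subset_insert _ _, ?_, ?_⟩
    · refine connected_of_reflTransGen (r := x c) (Or.inl rfl) ?_
      rintro v (rfl | hv)
      · exact .refl
      · by_cases h : c.1 ∉ S ∨ v ∈ C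
        · exact .single (Or.inl (Or.inl ⟨rfl, hv, h⟩))
        · push Not at h
          exact (Relation.ReflTransGen.single (b := c.1)
            (Or.inl (Or.inl ⟨rfl, h.1, Or.inr c.2⟩))).tail (Or.inl (Or.inr ⟨rfl, h.1, hv, h.2⟩))
    · rintro c d hcd v (hc | hc) (hd | hd)
      · exact absurd (hxinj (hc.symm.trans hd)) hcd
      · exact hd
      · exact hc
      · exact hc
    · have key : ∀ c d, c ≠ d → ∀ p q, E c p q → ¬ E d p q ∧ ¬ E d q p := by
        intro c d hcd p q hc
        have h1 := hxS c
        have h2 := hxS d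
        have h3 := hxinj.ne hcd
        have h4 : c.1 ≠ d.1 := fun h => hcd (Subtype.ext h)
        have h5 := c.2
        have h6 := d.2
        simp only [E] at hc ⊢
        grind
      rintro c d hcd p q (hc | hc) (hd | hd)
      · exact (key c d hcd p q hc).1 hd
      · exact (key c d hcd p q hc).2 hd
      · exact (key c d hcd q p hc).2 hd
      · exact (key c d hcd q p hc).1 hd
  have := hT.le_treeConnectivity (by lia)
  rwa [Fintype.card_coe, card_splitClique] at this

lemma genConnectivity_splitGraph (k : ℕ) : genConnectivity 3 (splitGraph k) = k :=
  le_antisymm ((genConnectivity_le_card_neighbors (by simp) (splitClique k)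
    adj_last_splitGraph).trans_eq (card_splitClique k)) (le_genConnectivity_splitGraph k)

end GenConn

theorem theorem3p1 :
    -- the bound (i) for every finite graph and every path
    (∀ (V : Type*) [Finite V] (G : SimpleGraph V) (m : ℕ), 1 ≤ m →
      GenConn.genConnectivity 3 G = GenConn.vertexConnectivity G →
      1 ≤ GenConn.vertexConnectivity G →
      GenConn.genConnectivity 3 G ≤
        GenConn.genConnectivity 3 (G.boxProd (SimpleGraph.pathGraph m))) ∧
    -- (i) is sharp, for every value of the connectivity
    (∀ k : ℕ, 1 ≤ k → ∃ (N : ℕ) (G : SimpleGraph (Fin N)),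
      GenConn.genConnectivity 3 G = k ∧ GenConn.vertexConnectivity G = k ∧
      GenConn.genConnectivity 3 (G.boxProd (SimpleGraph.pathGraph 2)) = k) ∧
    -- the bound (ii) for every finite graph and every path with at least two vertices
    (∀ (V : Type*) [Finite V] (G : SimpleGraph V) (m : ℕ), 2 ≤ m →
      1 ≤ GenConn.genConnectivity 3 G →
      GenConn.genConnectivity 3 G < GenConn.vertexConnectivity G →
      GenConn.genConnectivity 3 G + 1 ≤
        GenConn.genConnectivity 3 (G.boxProd (SimpleGraph.pathGraph m))) ∧
    -- (ii) is sharp, for every value of the 3-connectivity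
    (∀ k : ℕ, 1 ≤ k → ∃ (N : ℕ) (G : SimpleGraph (Fin N)),
      GenConn.genConnectivity 3 G = k ∧ k < GenConn.vertexConnectivity G ∧
      GenConn.genConnectivity 3 (G.boxProd (SimpleGraph.pathGraph 2)) = k + 1) := by
  refine ⟨fun V _ G m hm h hpos => ?_, fun k hk => ?_, fun V _ G m hm hpos h => ?_,
    fun k hk => ?_⟩
  · obtain ⟨n, rfl⟩ := Nat.exists_eq_add_of_le' hm
    exact GenConn.genConnectivity_le_boxProd (SimpleGraph.pathGraph_connected n) h hpos
  · have hκ := GenConn.vertexConnectivity_splitGraph k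
    have hκ₃ := GenConn.genConnectivity_splitGraph k
    refine ⟨k + 3, GenConn.splitGraph k, hκ₃, hκ, le_antisymm ?_ ?_⟩
    · exact (GenConn.genConnectivity_boxProd_pathGraph_two_le (by simp) (GenConn.splitClique k)
        GenConn.adj_last_splitGraph).trans_eq (GenConn.card_splitClique k)
    · have := GenConn.genConnectivity_le_boxProd (SimpleGraph.pathGraph_connected 1)
        (hκ₃.trans hκ.symm) (hk.trans_eq hκ.symm)
      rwa [hκ₃] at this
  · obtain ⟨n, rfl⟩ := Nat.exists_eq_add_of_le' hm
    exact GenConn.genConnectivity_succ_le_boxProd (SimpleGraph.pathGraph_connected (n + 1)) hpos h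
  · have hκ₃ := GenConn.genConnectivity_top k hk
    have hlt := GenConn.lt_vertexConnectivity_top k
    refine ⟨k + 2, ⊤, hκ₃, hlt, le_antisymm ?_ ?_⟩
    · exact (GenConn.genConnectivity_boxProd_pathGraph_two_le (by simp) {0}ᶜ
        fun w hw => by simpa using hw.ne.symm).trans_eq (GenConn.card_compl_zero k)
    · have := GenConn.genConnectivity_succ_le_boxProd (SimpleGraph.pathGraph_connected 1)
        (hk.trans_eq hκ₃.symm) (hκ₃.trans_lt hlt)
      rwa [hκ₃] at this
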